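/- Let $\mathbf{k}$ be a nonzero commutative ring containing $\mathbb{Q}$. An \emph{umbra} $\alpha$ with moments in $\mathbf{k}$ is a letter of an alphabet $\mathcal{A}$ carrying a sequence $a_0=1,a_1,a_2,\ldots$ in $\mathbf{k}$; every such sequence is carried by infinitely many letters. Put $\mathbf{F}=\mathbf{k}[x,y]$. The evaluation $\mathbf{E}:\mathbf{F}[\mathcal{A}]\to\mathbf{F}$ is the $\mathbf{F}$-linear map with $\mathbf{E}[1]=1$ that sends $\alpha^j$ to the $j$-th term of the sequence of $\alpha$ and is multiplicative on monomials with no letter in common. Write $p\simeq q$ when $\mathbf{E}[p]=\mathbf{E}[q]$, and $p\equiv q$ when $p^j\simeq q^j$ for all $j\ge 0$. For $n\ge 0$, $n.\alpha$ denotes an auxiliary umbra with $n.\alpha\equiv\alpha_1+\cdots+\alpha_n$, where $\alpha_1,\ldots,\alpha_n$ are distinct umbrae with $\alpha_i\equiv\alpha$. A sequence $p_0(x),p_1(x),p_2(x),\ldots$ of polynomials with $p_n(x)$ of degree $n$ is of \emph{binomial type} when $p_n(x+y)=\sum_{i=0}^n\binom{n}{i}p_i(x)\,p_{n-i}(y)$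 for all $n\ge 0$. \textbf{Theorem.} Let $p_n(x)\in\mathbf{k}[x]$, $n\ge 0$, be a sequence of polynomials with $p_1(x)=x$ and $p_n(x)$ of degree $n$ for every $n$. The sequence $p_n(x)$ is of binomial type if and only if there exists an umbra $\alpha$ with moments in $\mathbf{k}$ such that \[ p_n(x)\simeq x(x+n.\alpha)^{n-1}\qquad\text{for all } n\ge 0, \] where for $n=0$ the right-hand side is read as $x\cdot x^{-1}=1$. -/

import Mathlib

open MvPolynomial

noncomputable section

namespace UmbralCalculus

universe u v w

/-- Given an alphabet `A` and, for each letter `a`, its sequence of moments `m a 0, m a 1, …`,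
the `F`-linear functional on `F[A]` that sends a monomial `∏ a ^ (d a)` to `∏ m a (d a)`;
that is, distinct letters behave as independent random variables. -/
def evaluation {F : Type u} [CommRing F] {A : Type v} (m : A → ℕ → F) :
    MvPolynomial A F →ₗ[F] F :=
  (basisMonomials A F).constr F fun d => d.prod m

theorem evaluation_monomial {F : Type u} [CommRing F] {A : Type v} (m : A → ℕ → F)
    (d : A →₀ ℕ) (r : F) : evaluation m (monomial d r) = r * d.prod m := by
  have h : evaluation m (monomial d 1) = d.prod m := by
    simpa [evaluation] using (basisMonomials A F).constr_basis F (fun d => d.prod m) d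
  rw [← mul_one r, ← smul_eq_mul, ← smul_monomial, map_smul, h]
  simp

theorem evaluation_C {F : Type u} [CommRing F] {A : Type v} (m : A → ℕ → F) (r : F) :
    evaluation m (C r) = r := by
  rw [C_apply, evaluation_monomial]
  simp

theorem evaluation_one {F : Type u} [CommRing F] {A : Type v} (m : A → ℕ → F) :
    evaluation m 1 = 1 := by
  rw [← C_1, evaluation_C]

theorem evaluation_X_pow {F : Type u} [CommRing F] {A : Type v} {m : A → ℕ → F}
    (hm : ∀ a, m a 0 = 1) (a : A) (j : ℕ) : evaluation m (X a ^ j) = m a j := by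
  rw [X_pow_eq_monomial, evaluation_monomial, Finsupp.prod_single_index (hm a), one_mul]

/-- Multiplicativity on monomials that have no letter in common. -/
theorem evaluation_monomial_mul {F : Type u} [CommRing F] {A : Type v} (m : A → ℕ → F)
    {d e : A →₀ ℕ} (h : Disjoint d.support e.support) :
    evaluation m (monomial d 1 * monomial e 1) =
      evaluation m (monomial d 1) * evaluation m (monomial e 1) := by
  classical
  simp only [monomial_mul, evaluation_monomial, one_mul]
  exact Finsupp.prod_add_index_of_disjoint h m

theorem evaluation_rename {F : Type u} [CommRing F] {A : Type v} {B : Type w} (m : B → ℕ → F)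
    {f : A → B} (hf : Function.Injective f) (p : MvPolynomial A F) :
    evaluation m (rename f p) = evaluation (m ∘ f) p := by
  induction p using MvPolynomial.induction_on' with
  | monomial d r =>
    rw [rename_monomial, evaluation_monomial, evaluation_monomial,
      Finsupp.prod_mapDomain_index_inj hf]
    rfl
  | add p q hp hq => simp only [map_add, hp, hq]

/-- The non-auxiliary umbrae over `F`: for each sequence in `F` with initial term `1` there is
an infinite supply of umbrae, labelled by `ℕ`, that represent it. -/
def BaseUmbra (F : Type u) [CommRing F] : Type u :=
  {a : ℕ → F // a 0 = 1} × ℕ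

/-- The sequence represented by a base umbra. -/
def BaseUmbra.moment {F : Type u} [CommRing F] (α : BaseUmbra F) (j : ℕ) : F :=
  α.1.1 j

/-- The `i`-th copy of a base umbra. -/
def BaseUmbra.copy {F : Type u} [CommRing F] (α : BaseUmbra F) (i : ℕ) : BaseUmbra F :=
  (α.1, i)

/-- The alphabet of all umbrae: the base umbrae, and an auxiliary umbra `n.α` for each natural
number `n` and each base umbra `α`. -/
inductive Umbra (F : Type u) [CommRing F] : Type u
  | base (α : BaseUmbra F) : Umbra F
  | dot (n : ℕ) (α : BaseUmbra F) : Umbra F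

/-- The moments of an umbra. Those of the auxiliary umbra `n.α` are the moments of
`α₁ + ⋯ + αₙ`, where `α₁, …, αₙ` are distinct copies of `α`. -/
def Umbra.moment {F : Type u} [CommRing F] : Umbra F → ℕ → F
  | .base α, j => α.moment j
  | .dot n α, j => evaluation BaseUmbra.moment ((∑ i : Fin n, X (α.copy i)) ^ j)

/-- The evaluation map `E : F[𝒜] → F`. -/
def E {F : Type u} [CommRing F] : MvPolynomial (Umbra F) F →ₗ[F] F :=
  evaluation Umbra.moment

/-- Umbral equivalence `p ≃ q`. -/
def UmbrallyEquivalent {F : Type u} [CommRing F] (p q : MvPolynomial (Umbra F) F) : Prop :=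
  E p = E q

/-- Umbral exchangeability `p ≡ q`. -/
def Exchangeable {F : Type u} [CommRing F] (p q : MvPolynomial (Umbra F) F) : Prop :=
  ∀ j : ℕ, UmbrallyEquivalent (p ^ j) (q ^ j)

theorem Umbra.moment_zero {F : Type u} [CommRing F] (a : Umbra F) : a.moment 0 = 1 := by
  cases a with
  | base α => exact α.1.2
  | dot n α => simp [Umbra.moment, evaluation_one]

theorem E_X_pow {F : Type u} [CommRing F] (a : Umbra F) (j : ℕ) : E (X a ^ j) = a.moment j :=
  evaluation_X_pow Umbra.moment_zero a j

/-- The umbra `n.α` is exchangeable with the sum of any `n` distinct base umbrae each of which is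
exchangeable with `α`. -/
theorem dot_exchangeable {F : Type u} [CommRing F] (n : ℕ) (α : BaseUmbra F)
    (β : Fin n → BaseUmbra F) (hβ : Function.Injective β)
    (h : ∀ i, Exchangeable (X (Umbra.base (β i))) (X (Umbra.base α))) :
    Exchangeable (X (Umbra.dot n α)) (∑ i, X (Umbra.base (β i))) := by
  intro j
  have hc : Function.Injective fun i : Fin n => α.copy i := fun i i' hi =>
    Fin.ext (congrArg Prod.snd hi)
  have hb : Function.Injective fun i : Fin n => Umbra.base (β i) := fun i i' hi =>
    hβ (Umbra.base.inj hi)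
  have hm : (Umbra.moment ∘ fun i : Fin n => Umbra.base (β i)) =
      (BaseUmbra.moment ∘ fun i : Fin n => α.copy i) := by
    funext i j
    have := h i j
    rw [UmbrallyEquivalent, E_X_pow, E_X_pow] at this
    exact this
  have h1 := evaluation_rename BaseUmbra.moment hc ((∑ i : Fin n, X i : MvPolynomial _ F) ^ j)
  have h2 := evaluation_rename Umbra.moment hb ((∑ i : Fin n, X i : MvPolynomial _ F) ^ j)
  simp only [map_pow, map_sum, rename_X] at h1 h2
  rw [UmbrallyEquivalent, E_X_pow]
  simp only [Umbra.moment, E]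
  rw [h1, h2, hm]

/-- The ring `k[x, y]`. -/
abbrev Scalars (k : Type u) [CommRing k] : Type u := MvPolynomial (Fin 2) k

/-- The indeterminate `x` of `k[x, y]`. -/
def x {k : Type u} [CommRing k] : Scalars k := X 0

/-- The indeterminate `y` of `k[x, y]`. -/
def y {k : Type u} [CommRing k] : Scalars k := X 1

/-- A sequence of polynomials `p₀, p₁, …`, with `pₙ` of degree `n`, is of binomial type when
`pₙ(x + y) = ∑ᵢ (n choose i) pᵢ(x) pₙ₋ᵢ(y)` for all `n ≥ 0`. -/
def IsBinomialType {k : Type u} [CommRing k] (p : ℕ → Polynomial k) : Prop :=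
  (∀ n, (p n).degree = n) ∧
    ∀ n, Polynomial.aeval (x + y : Scalars k) (p n) =
      ∑ i ∈ Finset.range (n + 1), (n.choose i : Scalars k) *
        Polynomial.aeval (x : Scalars k) (p i) * Polynomial.aeval (y : Scalars k) (p (n - i))

/-- An umbra over `k[x, y]` all of whose moments are constants, that is, lie in `k`. -/
def IsScalar {k : Type u} [CommRing k] (α : BaseUmbra (Scalars k)) : Prop :=
  ∀ j : ℕ, ∃ c : k, E (X (Umbra.base α) ^ j) = C c

/-- The umbral polynomial `x (x + n.α) ^ (n - 1)`; for `n = 0`, where `0.α` stands for `0`, this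
is `x * x⁻¹ = 1`. -/
def abel {k : Type u} [CommRing k] (α : BaseUmbra (Scalars k)) :
    ℕ → MvPolynomial (Umbra (Scalars k)) (Scalars k)
  | 0 => 1
  | n + 1 => C x * (C x + X (Umbra.dot (n + 1) α)) ^ n

end UmbralCalculus

end

/-! Write `T f = E f(X + α)`. Then `E (x + n.α)^j` is `T ^ n (X ^ j)` at `x`, so the right-hand side
becomes `A n = X * T ^ n (X ^ (n - 1))`. The operator `T` commutes with `D = d/dX` and with
translations, and `D (A (n+1)) = (n+1) T (A n)` (`derivative_abelPolynomial`). As `A (n+1)` vanishes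
at 0, induction expands `S (A n)` in the `A i` for every `S` commuting with `D` and `T`
(`map_abelPolynomial_eq_sum`).

With `S` a translation this is the binomial identity. With `S = D` it is the recursion that
`derivative_of_isBinomialType` gives for every binomial sequence. Conversely, choose the moments so
that `(n+1) E p_n(α)` is the linear coefficient of `p_(n+1)`: a unitriangular system, since `p_n` is
monic. Then `p` and `A` agree by induction. -/

namespace Polynomial

/-! ### Umbral shift operators and Abel polynomials -/

/-- The image of `X ^ n` under `f ↦ E f(X + α)`, where `α` has the moments `a`. -/
noncomputable def umbralShiftPow {R : Type*} [CommRing R] : ℕ → (ℕ → R) → Polynomial R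
  | 0, a => C (a 0)
  -- `(X + α)^(n+1) = X (X + α)^n + α (X + α)^n`; the extra factor `α` shifts the moments.
  | n + 1, a => X * umbralShiftPow n a + umbralShiftPow n (fun j => a (j + 1))

/-- The operator `f ↦ E f(X + α)`, where `α` has the moments `a`. -/
noncomputable def umbralShift {R : Type*} [CommRing R] (a : ℕ → R) :
    Polynomial R →ₗ[R] Polynomial R :=
  (Polynomial.basisMonomials R).constr R fun n => umbralShiftPow n a

/-- The Abel polynomial `X (X + n.α) ^ (n - 1)`, where `α` has the moments `a`. -/
noncomputable def abelPolynomial {R : Type*} [CommRing R] (a : ℕ → R) : ℕ → Polynomial R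
  | 0 => 1
  | n + 1 => Polynomial.X * (umbralShift a ^ (n + 1)) (Polynomial.X ^ n)

section Shift

variable {R : Type*} [CommRing R]

theorem umbralShift_X_pow (a : ℕ → R) (n : ℕ) :
    umbralShift a (X ^ n) = umbralShiftPow n a := by
  rw [X_pow_eq_monomial, umbralShift]
  simpa using (Polynomial.basisMonomials R).constr_basis R (fun n => umbralShiftPow n a) n

theorem umbralShift_one (a : ℕ → R) : umbralShift a 1 = C (a 0) := by
  simpa [umbralShiftPow] using umbralShift_X_pow a 0

/-- Linear maps that agree on powers of `X` are equal. -/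
theorem linearMap_eq_of_X_pow {M : Type*} [AddCommGroup M] [Module R M]
    (f g : Polynomial R →ₗ[R] M) (h : ∀ n, f (X ^ n) = g (X ^ n)) : f = g := by
  refine Polynomial.lhom_ext' fun n => LinearMap.ext_ring ?_
  simpa [X_pow_eq_monomial] using h n

theorem umbralShift_X_mul (a : ℕ → R) (f : Polynomial R) :
    umbralShift a (X * f) = X * umbralShift a f + umbralShift (fun j => a (j + 1)) f := by
  have := linearMap_eq_of_X_pow (umbralShift a ∘ₗ LinearMap.mulLeft R X)
    (LinearMap.mulLeft R X ∘ₗ umbralShift a + umbralShift (fun j => a (j + 1))) fun n => by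
      simp [← pow_succ', umbralShift_X_pow, umbralShiftPow]
  simpa using LinearMap.congr_fun this f

theorem umbralShift_comm (a b : ℕ → R) (f : Polynomial R) :
    umbralShift a (umbralShift b f) = umbralShift b (umbralShift a f) := by
  have := linearMap_eq_of_X_pow (umbralShift a ∘ₗ umbralShift b)
    (umbralShift b ∘ₗ umbralShift a) fun n => by
      induction n generalizing a b with
      | zero =>
        simp only [LinearMap.comp_apply, pow_zero, umbralShift_one,
          C_eq_algebraMap, Algebra.algebraMap_eq_smul_one, map_smul]
        rw [smul_comm]
      | succ n ih =>
        simp only [LinearMap.comp_apply] at ih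
        simp only [LinearMap.comp_apply, pow_succ', umbralShift_X_mul, map_add, ih]
        abel
  exact LinearMap.congr_fun this f

theorem derivative_umbralShift (a : ℕ → R) (f : Polynomial R) :
    derivative (umbralShift a f) = umbralShift a (derivative f) := by
  have := linearMap_eq_of_X_pow (derivative ∘ₗ umbralShift a) (umbralShift a ∘ₗ derivative)
    fun n => by
      induction n generalizing a with
      | zero => simp [umbralShift_one]
      | succ n ih =>
        simp only [LinearMap.comp_apply] at ih
        simp only [LinearMap.comp_apply, pow_succ', umbralShift_X_mul, map_add, ih,
          derivative_mul, derivative_X, one_mul]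
        abel
  exact LinearMap.congr_fun this f

theorem derivative_umbralShift_pow (a : ℕ → R) (n : ℕ) (f : Polynomial R) :
    derivative ((umbralShift a ^ n) f) = (umbralShift a ^ n) (derivative f) := by
  induction n generalizing f with
  | zero => rfl
  | succ n ih => rw [pow_succ, Module.End.mul_apply, Module.End.mul_apply, ih,
      derivative_umbralShift]

theorem taylor_umbralShift (a : ℕ → R) (r : R) (f : Polynomial R) :
    taylor r (umbralShift a f) = umbralShift a (taylor r f) := by
  have := linearMap_eq_of_X_pow (taylor r ∘ₗ umbralShift a) (umbralShift a ∘ₗ taylor r)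
    fun n => by
      induction n generalizing a with
      | zero => simp [umbralShift_one]
      | succ n ih =>
        simp only [LinearMap.comp_apply] at ih
        simp only [LinearMap.comp_apply, pow_succ', umbralShift_X_mul, map_add, ih,
          taylor_mul, taylor_X, add_mul, ← smul_eq_C_mul, map_smul]
        abel
  exact LinearMap.congr_fun this f

/-- The commutator of `T` with multiplication by `X` is the shift with moments `a (j + 1)`. It
commutes with `T`, so powers of `T` obey the power rule. -/
theorem umbralShift_pow_X_mul (a : ℕ → R) (n : ℕ) (f : Polynomial R) :
    (umbralShift a ^ (n + 1)) (X * f) = X * (umbralShift a ^ (n + 1)) f +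
      (n + 1 : R) • umbralShift (fun j => a (j + 1)) ((umbralShift a ^ n) f) := by
  induction n with
  | zero => simp [umbralShift_X_mul]
  | succ n ih =>
    rw [pow_succ', Module.End.mul_apply, ih, map_add, map_smul, umbralShift_X_mul,
      umbralShift_comm a, ← Module.End.mul_apply (umbralShift a), ← pow_succ',
      ← Module.End.mul_apply (umbralShift a), ← pow_succ']
    push_cast
    module

theorem coeff_zero_umbralShift (a : ℕ → R) (f : Polynomial R) :
    (umbralShift a f).coeff 0 = f.sum fun j c => c * a j := by
  have h (n : ℕ) : (umbralShiftPow n a).coeff 0 = a n := by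
    induction n generalizing a with
    | zero => simp [umbralShiftPow]
    | succ n ih => simp [umbralShiftPow, ih]
  conv_lhs => rw [f.as_sum_support_C_mul_X_pow]
  simp [← smul_eq_C_mul, umbralShift_X_pow, h, Polynomial.sum]

theorem map_umbralShift {S : Type*} [CommRing S] (φ : R →+* S) (a : ℕ → R) (f : Polynomial R) :
    (umbralShift a f).map φ = umbralShift (fun j => φ (a j)) (f.map φ) := by
  have h (n : ℕ) : (umbralShiftPow n a).map φ = umbralShiftPow n (fun j => φ (a j)) := by
    induction n generalizing a with
    | zero => simp [umbralShiftPow]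
    | succ n ih => simp [umbralShiftPow, ih]
  induction f using Polynomial.induction_on' with
  | add f g hf hg => simp [hf, hg]
  | monomial n c =>
    simp [← C_mul_X_pow_eq_monomial, ← smul_eq_C_mul, umbralShift_X_pow, h, Polynomial.map_smul]

theorem map_abelPolynomial {S : Type*} [CommRing S] (φ : R →+* S) (a : ℕ → R) (n : ℕ) :
    (abelPolynomial a n).map φ = abelPolynomial (fun j => φ (a j)) n := by
  have h (n : ℕ) (f : Polynomial R) : ((umbralShift a ^ n) f).map φ =
      (umbralShift (fun j => φ (a j)) ^ n) (f.map φ) := by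
    induction n generalizing f with
    | zero => rfl
    | succ n ih => rw [pow_succ, Module.End.mul_apply, ih, map_umbralShift, pow_succ,
        Module.End.mul_apply]
  cases n with
  | zero => simp [abelPolynomial]
  | succ n => simp [abelPolynomial, h]

theorem derivative_abelPolynomial {a : ℕ → R} (ha : a 0 = 1) (n : ℕ) :
    derivative (abelPolynomial a (n + 1)) =
      (n + 1 : R) • umbralShift a (abelPolynomial a n) := by
  cases n with
  | zero => simp [abelPolynomial, umbralShift_one, ha]
  | succ n =>
    simp only [abelPolynomial]
    rw [derivative_mul, derivative_X, one_mul, derivative_umbralShift_pow, derivative_X_pow,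
      ← smul_eq_C_mul, map_smul, Nat.add_sub_cancel, pow_succ' X n, umbralShift_pow_X_mul,
      umbralShift_X_mul, ← Module.End.mul_apply (umbralShift a), ← pow_succ', mul_smul_comm]
    push_cast
    module

theorem eval_zero_abelPolynomial (a : ℕ → R) (n : ℕ) :
    (abelPolynomial a (n + 1)).eval 0 = 0 := by
  simp [abelPolynomial]

theorem isUnit_natCast_add_one (R : Type*) [CommRing R] [Algebra ℚ R] (n : ℕ) :
    IsUnit ((n : R) + 1) := by
  have := (IsUnit.mk0 ((n : ℚ) + 1) (by positivity)).map (algebraMap ℚ R)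
  simpa using this

theorem eq_of_derivative_eq [Algebra ℚ R] {f g : Polynomial R}
    (h : derivative f = derivative g) (h0 : f.coeff 0 = g.coeff 0) : f = g := by
  ext n
  cases n with
  | zero => exact h0
  | succ n =>
    have h1 := congrArg (fun f => f.coeff n) h
    simp only [coeff_derivative] at h1
    exact (isUnit_natCast_add_one R n).mul_right_cancel h1

/-- Expansion of an operator that commutes with shifts in terms of Abel polynomials. -/
theorem map_abelPolynomial_eq_sum [Algebra ℚ R] {a : ℕ → R} (ha : a 0 = 1)
    (T : Polynomial R →ₗ[R] Polynomial R) (hD : ∀ f, derivative (T f) = T (derivative f))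
    (hA : ∀ f, T (umbralShift a f) = umbralShift a (T f)) (n : ℕ) :
    T (abelPolynomial a n) = ∑ i ∈ Finset.range (n + 1),
      ((n.choose i : R) * (T (abelPolynomial a (n - i))).eval 0) • abelPolynomial a i := by
  induction n with
  | zero =>
    refine eq_of_derivative_eq ?_ ?_
    · simp [abelPolynomial, hD]
    · simp [abelPolynomial, coeff_zero_eq_eval_zero]
  | succ n ih =>
    -- On derivatives the `i = 0` term dies and the rest is `(n+1) T` of the inductive hypothesis;
    -- at 0 only the `i = 0` term survives.
    refine eq_of_derivative_eq ?_ ?_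
    · rw [hD, derivative_abelPolynomial ha, map_smul, hA, ih, map_sum, map_sum,
        Finset.sum_range_succ' _ (n + 1), Finset.smul_sum]
      have h0 : derivative (((((n + 1).choose 0 : ℕ) : R) *
          (T (abelPolynomial a (n + 1 - 0))).eval 0) • abelPolynomial a 0) = 0 := by
        simp [abelPolynomial]
      rw [h0, add_zero]
      refine Finset.sum_congr rfl fun i _ => ?_
      rw [map_smul, derivative_smul, derivative_abelPolynomial ha, smul_smul, smul_smul,
        Nat.add_sub_add_right]
      congr 1
      have hc : ((n : R) + 1) * (n.choose i : R) = ((n + 1).choose (i + 1) : R) * (i + 1) := by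
        have := congrArg (Nat.cast (R := R)) (Nat.add_one_mul_choose_eq n i)
        push_cast at this
        exact this
      linear_combination (eval 0 (T (abelPolynomial a (n - i)))) * hc
    · rw [Finset.sum_range_succ']
      simp only [coeff_zero_eq_eval_zero, eval_add, eval_finsetSum, eval_smul,
        eval_zero_abelPolynomial]
      simp [abelPolynomial]

theorem eval_add_abelPolynomial [Algebra ℚ R] {a : ℕ → R} (ha : a 0 = 1) (r s : R) (n : ℕ) :
    (abelPolynomial a n).eval (r + s) = ∑ i ∈ Finset.range (n + 1),
      (n.choose i : R) * (abelPolynomial a i).eval r * (abelPolynomial a (n - i)).eval s := by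
  have h := map_abelPolynomial_eq_sum ha (taylor s)
    (fun f => by simp [taylor_apply, derivative_comp]) (taylor_umbralShift a s) n
  rw [← taylor_eval, h, eval_finsetSum]
  refine Finset.sum_congr rfl fun i _ => ?_
  rw [eval_smul, smul_eq_mul, taylor_eval, zero_add]
  ring

end Shift

end Polynomial

/-! ### From umbral evaluation to operators -/

namespace UmbralCalculus

section Evaluation

open MvPolynomial

variable {F : Type*} [CommRing F] {A : Type*}

theorem evaluation_mul_X_pow {m : A → ℕ → F} (hm : ∀ a, m a 0 = 1) {a : A}
    {Q : MvPolynomial A F} (hQ : Q ∈ supported F ({a}ᶜ : Set A)) (l : ℕ) :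
    evaluation m (Q * X a ^ l) = evaluation m Q * m a l := by
  classical
  conv_lhs => rw [Q.as_sum]
  conv_rhs => rw [Q.as_sum]
  rw [Finset.sum_mul, map_sum, map_sum, Finset.sum_mul]
  refine Finset.sum_congr rfl fun d hd => ?_
  have hda : a ∉ d.support := fun h => by
    have := mem_supported.1 hQ (Finset.mem_coe.2 (mem_vars_iff_mem_support a |>.2 ⟨d, hd, h⟩))
    exact this rfl
  have hdis : Disjoint d.support (Finsupp.single a l).support :=
    (Finset.disjoint_singleton_right.2 hda).mono_right Finsupp.support_single_subset
  rw [X_pow_eq_monomial, monomial_mul, mul_one, evaluation_monomial, evaluation_monomial,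
    Finsupp.prod_add_index_of_disjoint hdis, Finsupp.prod_single_index (hm a), mul_assoc]

/-- A letter independent of `P` can be integrated out first, which applies its umbral shift to `f`.
-/
theorem evaluation_aeval_add_X {m : A → ℕ → F} (hm : ∀ a, m a 0 = 1) {a : A}
    {P : MvPolynomial A F} (hP : P ∈ supported F ({a}ᶜ : Set A)) (f : Polynomial F) :
    evaluation m (Polynomial.aeval (P + X a) f) =
      evaluation m (Polynomial.aeval P (Polynomial.umbralShift (m a) f)) := by
  -- The factors `Q` and `X a ^ l` collect what the induction on `j` splits off from `(P + X a) ^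
  -- j`.
  have key (j l : ℕ) (Q : MvPolynomial A F) (hQ : Q ∈ supported F ({a}ᶜ : Set A)) :
      evaluation m (Q * X a ^ l * (P + X a) ^ j) = evaluation m
        (Q * Polynomial.aeval P (Polynomial.umbralShiftPow j fun i => m a (i + l))) := by
    induction j generalizing l Q with
    | zero =>
      rw [pow_zero, mul_one, evaluation_mul_X_pow hm hQ]
      simp only [Polynomial.umbralShiftPow, Polynomial.aeval_C, algebraMap_eq, zero_add]
      rw [mul_comm Q, C_mul', map_smul, smul_eq_mul, mul_comm]
    | succ j ih =>
      have e : Q * X a ^ l * (P + X a) ^ (j + 1) = Q * P * X a ^ l * (P + X a) ^ j +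
        Q * X a ^ (l + 1) * (P + X a) ^ j := by ring
      rw [e, map_add, ih _ _ (mul_mem hQ hP), ih _ _ hQ, Polynomial.umbralShiftPow,
        map_add (Polynomial.aeval P), map_mul (Polynomial.aeval P), Polynomial.aeval_X, mul_add,
        map_add, mul_assoc]
      simp only [add_assoc, add_comm 1 l]
  have := Polynomial.linearMap_eq_of_X_pow (evaluation m ∘ₗ (Polynomial.aeval (P + X a)).toLinearMap)
    (evaluation m ∘ₗ (Polynomial.aeval P).toLinearMap ∘ₗ Polynomial.umbralShift (m a)) fun j => by
      simpa [Polynomial.umbralShift_X_pow] using key j 0 1 (one_mem _)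
  exact LinearMap.congr_fun this f

theorem evaluation_aeval_copies (α : BaseUmbra F) (z : F) (n : ℕ) (f : Polynomial F) :
    evaluation BaseUmbra.moment
      (Polynomial.aeval (C z + ∑ i : Fin n, X (α.copy i) : MvPolynomial (BaseUmbra F) F) f) =
      ((Polynomial.umbralShift α.moment ^ n) f).eval z := by
  induction n generalizing f with
  | zero =>
    have : Polynomial.aeval (C z : MvPolynomial (BaseUmbra F) F) f = C (f.eval z) := by
      rw [← algebraMap_eq, Polynomial.aeval_algebraMap_apply, Polynomial.coe_aeval_eq_eval]
    simp [this, evaluation_C]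
  | succ n ih =>
    have hP : (C z + ∑ i : Fin n, X (α.copy i) : MvPolynomial (BaseUmbra F) F) ∈
        supported F ({α.copy n}ᶜ : Set (BaseUmbra F)) := by
      refine add_mem (Subalgebra.algebraMap_mem _ z) (sum_mem fun i _ => ?_)
      refine Algebra.subset_adjoin ⟨_, fun h => ?_, rfl⟩
      exact i.2.ne (congrArg Prod.snd h)
    rw [Fin.sum_univ_castSucc, ← add_assoc]
    simp only [Fin.val_castSucc, Fin.val_last]
    rw [evaluation_aeval_add_X (m := BaseUmbra.moment) (fun a => a.1.2) hP, pow_succ, Module.End.mul_apply]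
    exact ih _

theorem E_C_mul (r : F) (p : MvPolynomial (Umbra F) F) : E (C r * p) = r * E p := by
  rw [C_mul', map_smul, smul_eq_mul]

theorem E_add_dot_pow (α : BaseUmbra F) (z : F) (n j : ℕ) :
    E ((C z + X (Umbra.dot n α)) ^ j) =
      ((Polynomial.umbralShift α.moment ^ n) (Polynomial.X ^ j)).eval z := by
  -- Both binomial expansions involve only powers of `n.α` and of the sum of copies, whose
  -- evaluations agree by definition.
  rw [← evaluation_aeval_copies, map_pow (Polynomial.aeval _), Polynomial.aeval_X, add_pow, add_pow, map_sum, map_sum]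
  refine Finset.sum_congr rfl fun i _ => ?_
  have e (B : Type _) (v : MvPolynomial B F) : C z ^ i * v ^ (j - i) * ((j.choose i : ℕ) : MvPolynomial B F) =
      C (z ^ i * (j.choose i : F)) * v ^ (j - i) := by
    rw [C_mul, C_pow, map_natCast]; ring
  rw [e, e, E_C_mul, E_X_pow, C_mul', map_smul]
  rfl

end Evaluation

variable {k : Type*} [CommRing k]

theorem E_abel (α : BaseUmbra (Scalars k)) (n : ℕ) :
    E (abel α n) = (Polynomial.abelPolynomial α.moment n).eval x := by
  cases n with
  | zero => simp [abel, Polynomial.abelPolynomial, E, evaluation_one]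
  | succ n => rw [abel, E_C_mul, E_add_dot_pow]; simp [Polynomial.abelPolynomial]

theorem aeval_x_injective :
    Function.Injective (Polynomial.aeval (x : Scalars k) : Polynomial k →ₐ[k] Scalars k) := by
  refine Function.LeftInverse.injective
    (g := MvPolynomial.aeval fun _ => (Polynomial.X : Polynomial k)) fun f => ?_
  rw [← AlgHom.comp_apply]
  have : (MvPolynomial.aeval fun _ => (Polynomial.X : Polynomial k)).comp
      (Polynomial.aeval (x : Scalars k)) = AlgHom.id k _ := by
    ext; simp [x]
  rw [this]; rfl

theorem aeval_eq_eval_map (z : Scalars k) (f : Polynomial k) :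
    Polynomial.aeval z f = (f.map C).eval z := by
  rw [Polynomial.eval_map, Polynomial.aeval_def, algebraMap_eq]

end UmbralCalculus

/-! ### Sequences of binomial type -/

namespace Polynomial

open UmbralCalculus

variable {k : Type*} [CommRing k] {p : ℕ → Polynomial k}

theorem aeval_add_of_isBinomialType (hp : IsBinomialType p) {S : Type*} [CommRing S]
    [Algebra k S] (r s : S) (n : ℕ) :
    aeval (r + s) (p n) = ∑ i ∈ Finset.range (n + 1),
      (n.choose i : S) * aeval r (p i) * aeval s (p (n - i)) := by
  have := congrArg (MvPolynomial.aeval ![r, s]) (hp.2 n)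
  simpa [← aeval_algHom_apply, UmbralCalculus.x, UmbralCalculus.y] using this

/-- Compare coefficients of `Y` in the identity for `p_n(X + Y)` over `k[X][Y]`. -/
theorem derivative_of_isBinomialType (hp : IsBinomialType p) (n : ℕ) :
    derivative (p n) = ∑ i ∈ Finset.range (n + 1),
      ((n.choose i : k) * (p (n - i)).coeff 1) • p i := by
  have h := congrArg (fun f => coeff f 1)
    (aeval_add_of_isBinomialType hp (C X) (X : Polynomial (Polynomial k)) n)
  have h1 (f : Polynomial k) : aeval (C X + X : Polynomial (Polynomial k)) f =
      taylor X (f.map C) := by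
    rw [taylor_apply, add_comm, aeval_def, comp, eval₂_map]; rfl
  have h2 (f : Polynomial k) : aeval (C X : Polynomial (Polynomial k)) f = C f := by
    rw [C_eq_algebraMap, aeval_algebraMap_apply]; simp
  have h3 (f : Polynomial k) : aeval (X : Polynomial (Polynomial k)) f = f.map C := by
    rw [aeval_def, map]; rfl
  simp only [h1, h2, h3, taylor_coeff_one, derivative_map, finsetSum_coeff] at h
  rw [eval_map, eval₂_C_X] at h
  rw [h]
  refine Finset.sum_congr rfl fun i _ => ?_
  rw [← C_eq_natCast, ← C_mul, coeff_C_mul, coeff_map, smul_eq_C_mul, C_mul, C_eq_natCast]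
  ring

theorem coeff_of_isBinomialType_of_lt (hp : IsBinomialType p) {n j : ℕ} (h : n < j) :
    (p n).coeff j = 0 :=
  coeff_eq_zero_of_degree_lt (by rw [hp.1]; exact_mod_cast h)

theorem isBinomialType_zero (hp : IsBinomialType p) (hp1 : p 1 = X) : p 0 = 1 := by
  have h := derivative_of_isBinomialType hp 1
  simpa [Finset.sum_range_succ, hp1, coeff_of_isBinomialType_of_lt hp zero_lt_one] using h.symm

theorem coeff_zero_of_isBinomialType (hp : IsBinomialType p) (hp1 : p 1 = X) (n : ℕ) :
    (p (n + 1)).coeff 0 = 0 := by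
  induction n using Nat.strong_induction_on with
  | _ n ih =>
    have h := aeval_add_of_isBinomialType hp (0 : k) 0 (n + 1)
    -- At `(0, 0)` each of the two extreme terms equals the left-hand side, and the middle ones
    -- vanish by induction.
    rw [Finset.sum_range_succ, Finset.sum_range_succ', Finset.sum_eq_zero fun i hi => ?_] at h
    · simpa [isBinomialType_zero hp hp1, ← coeff_zero_eq_aeval_zero] using h
    · simp [← coeff_zero_eq_aeval_zero, ih i (Finset.mem_range.1 hi)]

theorem coeff_self_of_isBinomialType [Algebra ℚ k] (hp : IsBinomialType p) (hp1 : p 1 = X)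
    (n : ℕ) : (p n).coeff n = 1 := by
  induction n with
  | zero => simp [isBinomialType_zero hp hp1]
  | succ n ih =>
    have h := congrArg (fun f => coeff f n) (derivative_of_isBinomialType hp (n + 1))
    simp only [coeff_derivative, finsetSum_coeff, coeff_smul, smul_eq_mul] at h
    -- Only `i = n` contributes: lower `p i` have degree below `n`, and `p 0` has no linear term.
    rw [Finset.sum_range_succ, Finset.sum_range_succ, Finset.sum_eq_zero fun i hi => ?_] at h
    · refine (isUnit_natCast_add_one k n).mul_right_cancel (h.trans ?_)
      simp [ih, hp1, coeff_of_isBinomialType_of_lt hp zero_lt_one]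
    · rw [coeff_of_isBinomialType_of_lt hp (Finset.mem_range.1 hi), mul_zero]

/-- The solution of a unitriangular system of linear equations. -/
noncomputable def triangularSolution {R : Type*} [CommRing R] (u : ℕ → R) (c : ℕ → ℕ → R)
    (n : ℕ) : R :=
  u n - ∑ j : Fin n, c n j * triangularSolution u c j
termination_by n
decreasing_by exact j.2

theorem sum_triangularSolution {R : Type*} [CommRing R] (u : ℕ → R) {c : ℕ → ℕ → R}
    (hc : ∀ n, c n n = 1) (n : ℕ) :
    ∑ j ∈ Finset.range (n + 1), c n j * triangularSolution u c j = u n := by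
  rw [Finset.sum_range_succ, hc, triangularSolution.eq_1 u c n, ← Fin.sum_univ_eq_sum_range
    (fun j => c n j * triangularSolution u c j)]
  ring

theorem exists_eq_abelPolynomial [Algebra ℚ k] (hp : IsBinomialType p) (hp1 : p 1 = X) :
    ∃ a : ℕ → k, a 0 = 1 ∧ ∀ n, p n = abelPolynomial a n := by
  choose v hv using fun n => (isUnit_natCast_add_one k n).exists_right_inv
  have hs := sum_triangularSolution (fun n => v n * (p (n + 1)).coeff 1)
    (c := fun n j => (p n).coeff j) (coeff_self_of_isBinomialType hp hp1)
  set a := triangularSolution (fun n => v n * (p (n + 1)).coeff 1) (fun n j => (p n).coeff j)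
  have ha : a 0 = 1 := by
    have h0 := hs 0
    have hv0 := hv 0
    simp only [Nat.cast_zero, zero_add, one_mul] at hv0
    simpa [isBinomialType_zero hp hp1, hp1, hv0] using h0
  have hA (n : ℕ) : ((n : k) + 1) * (umbralShift a (p n)).coeff 0 = (p (n + 1)).coeff 1 := by
    rw [coeff_zero_umbralShift, sum_over_range' _ (by simp) (n + 1), hs, ← mul_assoc, hv, one_mul]
    exact Nat.lt_succ_of_le (natDegree_le_of_degree_le (hp.1 n).le)
  refine ⟨a, ha, fun n => ?_⟩
  induction n using Nat.strong_induction_on with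
  | _ n ih =>
    cases n with
    | zero => exact isBinomialType_zero hp hp1
    | succ n =>
      refine eq_of_derivative_eq ?_ ?_
      · rw [derivative_of_isBinomialType hp, map_abelPolynomial_eq_sum ha derivative
          (fun _ => rfl) (derivative_umbralShift a)]
        refine Finset.sum_congr rfl fun i hi => ?_
        rw [← coeff_zero_eq_eval_zero]
        -- The inductive hypothesis misses two terms: for `i = 0` the linear coefficients agree by
        -- the choice of `a`, and for `i = n + 1` the coefficient is zero.
        rcases Nat.eq_zero_or_pos i with rfl | hi0
        · rw [ih 0 n.succ_pos, Nat.sub_zero, derivative_abelPolynomial ha, coeff_smul,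
            ← ih n n.lt_succ_self, smul_eq_mul, hA]
        · rw [← ih (n + 1 - i) (by omega), coeff_derivative]
          rcases (Nat.lt_succ_iff.1 (Finset.mem_range.1 hi)).eq_or_lt with rfl | hin
          · simp [coeff_of_isBinomialType_of_lt hp zero_lt_one]
          · simp [ih i hin]
      · rw [coeff_zero_of_isBinomialType hp hp1, coeff_zero_eq_eval_zero, eval_zero_abelPolynomial]

end Polynomial

/-! ### The equivalence -/

theorem mainTheorem2 {k : Type*} [CommRing k] [Nontrivial k] [Algebra ℚ k]
    (p : ℕ → Polynomial k) (hp1 : p 1 = Polynomial.X) (hdeg : ∀ n, (p n).degree = n) :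
    UmbralCalculus.IsBinomialType p ↔
      ∃ α : UmbralCalculus.BaseUmbra (UmbralCalculus.Scalars k),
        UmbralCalculus.IsScalar α ∧
        ∀ n, UmbralCalculus.UmbrallyEquivalent
          (MvPolynomial.C (Polynomial.aeval (UmbralCalculus.x : UmbralCalculus.Scalars k) (p n)))
          (UmbralCalculus.abel α n) := by
  open UmbralCalculus in
  have hE (c : ℕ → k) (α : BaseUmbra (Scalars k)) (hα : ∀ j, α.moment j = MvPolynomial.C (c j))
      (n : ℕ) : E (abel α n) = Polynomial.aeval x (Polynomial.abelPolynomial c n) := by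
    rw [E_abel, aeval_eq_eval_map, Polynomial.map_abelPolynomial, funext hα]
  constructor
  · intro hp
    obtain ⟨a, ha, hpa⟩ := Polynomial.exists_eq_abelPolynomial hp hp1
    have h0 : MvPolynomial.C (a 0) = (1 : UmbralCalculus.Scalars k) := by rw [ha, map_one]
    let α : UmbralCalculus.BaseUmbra (UmbralCalculus.Scalars k) :=
      (⟨fun j => MvPolynomial.C (a j), h0⟩, 0)
    refine ⟨α, fun j => ⟨a j, ?_⟩, fun n => ?_⟩
    · rw [UmbralCalculus.E_X_pow]; rfl
    · rw [UmbralCalculus.UmbrallyEquivalent, hE a α fun _ => rfl, hpa]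
      exact UmbralCalculus.evaluation_C _ _
  · rintro ⟨α, hα, h⟩
    choose c hc using hα
    have hm (j : ℕ) : α.moment j = MvPolynomial.C (c j) := by
      rw [← hc, UmbralCalculus.E_X_pow]; rfl
    -- The moments are constants, so the equality in `k[x, y]` descends to `k[X]`.
    have hpc (n : ℕ) : p n = Polynomial.abelPolynomial c n := by
      refine UmbralCalculus.aeval_x_injective ?_
      rw [← hE c α hm, ← h n]
      exact (UmbralCalculus.evaluation_C _ _).symm
    refine ⟨hdeg, fun n => ?_⟩
    have h0 : α.moment 0 = 1 := α.1.2
    have e (z : UmbralCalculus.Scalars k) (n : ℕ) : Polynomial.aeval z (p n) =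
        (Polynomial.abelPolynomial α.moment n).eval z := by
      rw [hpc, UmbralCalculus.aeval_eq_eval_map, Polynomial.map_abelPolynomial, funext hm]
    simp only [e]
    exact Polynomial.eval_add_abelPolynomial h0 _ _ n
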